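/- Let $\|x\|_p=(\sum_i|x_i|^p)^{1/p}$ and, for $1<p<\infty$ and an integer $m\ge 1$, let $K_{p,m}=\{w\in\mathbb R^m : w_1\ge \|(w_2,\dots,w_m)\|_p\}$. For $w=(\|x\|_p;x)\in \operatorname{bd}K_{p,m}\setminus\{0\}$ (so $0\ne x\in\mathbb R^{m-1}$) let its conjugate vector be $w^\triangle=(\|y\|_q;-y)$, where $1/p+1/q=1$ and $y_i=\operatorname{sign}(x_i)|x_i|^{p-1}$. Let $K=K_1\times\dots\times K_t$ with $K_i=K_{p_i,m_i}$, $1<p_i<\infty$, $m_i\ge1$; let $Y=\mathbb R^{m_1}\times\dots\times\mathbb R^{m_t}$ with the Euclidean inner product, let $A:\mathbb R^n\to Y$ be linear, let $b\in Y$, and let $K^*=\{y\in Y:\langle y,s\rangle\ge0\ \forall s\in K\}$. Consider the system $P_p=\{x\in\mathbb R^n : b-Ax\in K\}$. It is called well-behaved if for every $c\in\mathbb R^n$ for which $\sup\{\langle c,x\rangle : x\in P_p\}$ is finite there is $y\in K^*$ with $A^*y=c$ and $\langle b,y\rangle=\sup\{\langle c,x\rangle : x\in P_p\}$; otherwise it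 is called badly behaved. A maximum slack in $P_p$ is a point of the relative interior of $\{s\in K : s=b-Ax \text{ for some } x\}$. **Theorem 4.2.** Let $z=(z_1;\dots;z_t)$ be a maximum slack in $P_p$, and let $O=\{i : z_i=0\}$ and $R=\{i : z_i\in\operatorname{bd}K_i\setminus\{0\}\}$ (for all remaining $i$, $z_i\in\operatorname{int}K_i$). Then $P_p$ is badly behaved if and only if there is a vector $v=(v_1;\dots;v_t)$ which is a linear combination of the columns of $A$ and of $b$ and satisfies $$v_i\in K_i\ \text{ for all } i\in O,\qquad \langle v_i,z_i^\triangle\rangle\ge 0\ \text{ for all } i\in R,$$ $$\langle v_j,z_j^\triangle\rangle=0\ \text{ and }\ v_j\notin\operatorname{lin}\{z_j\}\ \text{ for some } j\in R.$$ -/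

import Mathlib

open scoped InnerProductSpace

noncomputable section

namespace ConicSystem

section General

variable {X Y : Type*}
  [NormedAddCommGroup X] [InnerProductSpace ℝ X] [FiniteDimensional ℝ X]
  [NormedAddCommGroup Y] [InnerProductSpace ℝ Y] [FiniteDimensional ℝ Y]

/-- The conic system `P = {x | A x ≤_K b}`, where `s ≤_K t` means `t - s ∈ K`. -/
def feasible (A : X →ₗ[ℝ] Y) (b : Y) (K : Set Y) : Set X :=
  {x | b - A x ∈ K}

/-- The dual cone `K* = {y | ⟨y, x⟩ ≥ 0 for all x ∈ K}`. -/
def dualCone (K : Set Y) : Set Y :=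
  {y | ∀ x ∈ K, 0 ≤ ⟪y, x⟫_ℝ}

/-- The feasible set of the dual problem with objective `c`: `y ∈ K*` and `A* y = c`. -/
def dualFeasible (A : X →ₗ[ℝ] Y) (K : Set Y) (c : X) : Set Y :=
  {y | y ∈ dualCone K ∧ LinearMap.adjoint A y = c}

/-- `P` is well behaved if, for every objective `c` for which the value
`sup {⟨c, x⟩ | x ∈ P}` is finite, some dual feasible `y` has `⟨b, y⟩` equal to that value.
A set of reals has a real least upper bound exactly when it is nonempty and bounded above,
so `IsLUB` expresses that the value is the finite number `val`. -/
def WellBehaved (A : X →ₗ[ℝ] Y) (b : Y) (K : Set Y) : Prop :=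
  ∀ (c : X) (val : ℝ), IsLUB ((fun x => ⟪c, x⟫_ℝ) '' feasible A b K) val →
    ∃ y ∈ dualFeasible A K c, ⟪b, y⟫_ℝ = val

/-- `P` is badly behaved if it is not well behaved. -/
def BadlyBehaved (A : X →ₗ[ℝ] Y) (b : Y) (K : Set Y) : Prop :=
  ¬ WellBehaved A b K

/-- A maximum slack: a point of the relative interior of `{z | z = b - A x, z ∈ K}`. -/
def IsMaximumSlack (A : X →ₗ[ℝ] Y) (b : Y) (K : Set Y) (z : Y) : Prop :=
  z ∈ intrinsicInterior ℝ {s : Y | (∃ x, s = b - A x) ∧ s ∈ K}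

end General

/-- The `p`-norm `(|x_1|^p + ... + |x_k|^p)^(1/p)` on `ℝ^k`. -/
def pNorm (p : ℝ) {k : ℕ} (x : Fin k → ℝ) : ℝ :=
  (∑ i, |x i| ^ p) ^ (1 / p)

/-- The `p`-cone in `ℝ^(k+1)`: the first coordinate is at least the `p`-norm of the others. -/
def pCone (p : ℝ) (k : ℕ) : Set (EuclideanSpace ℝ (Fin (k + 1))) :=
  {w | pNorm p (fun i : Fin k => w i.succ) ≤ w 0}

/-- The vector with entries `sign (x_i) |x_i|^(p-1)`. -/
def dualDirection (p : ℝ) {k : ℕ} (x : Fin k → ℝ) : Fin k → ℝ :=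
  fun i => Real.sign (x i) * |x i| ^ (p - 1)

/-- The conjugate vector of `w = (‖x‖_p; x)`: the vector `(‖y‖_q; -y)`, where
`y_i = sign (x_i) |x_i|^(p-1)` and `1/p + 1/q = 1`. For `p = 2` it is `(‖x‖_2; -x)`. -/
def conjugateVector (p : ℝ) {k : ℕ} (w : EuclideanSpace ℝ (Fin (k + 1))) :
    EuclideanSpace ℝ (Fin (k + 1)) :=
  WithLp.toLp 2 (Fin.cons
    (pNorm (Real.conjExponent p) (dualDirection p (fun i : Fin k => w i.succ)))
    (fun i : Fin k => - dualDirection p (fun i : Fin k => w i.succ) i) : Fin (k + 1) → ℝ)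

/-- The space `ℝ^(m_1) × ... × ℝ^(m_t)` with its Euclidean inner product, where block `i` has
dimension `m_i = k i + 1`. -/
abbrev BlockSpace {t : ℕ} (k : Fin t → ℕ) : Type :=
  PiLp 2 (fun i : Fin t => EuclideanSpace ℝ (Fin (k i + 1)))

/-- The product `K_1 × ... × K_t` of `p`-cones, where `K_i` has exponent `p i`. -/
def pConeProd {t : ℕ} (p : Fin t → ℝ) (k : Fin t → ℕ) : Set (BlockSpace k) :=
  {z | ∀ i, z i ∈ pCone (p i) (k i)}

/-- The `j`-th column of `A`, that is, the image of the `j`-th unit vector. -/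
def column {n : ℕ} {Y : Type*} [NormedAddCommGroup Y] [InnerProductSpace ℝ Y]
    (A : EuclideanSpace ℝ (Fin n) →ₗ[ℝ] Y) (j : Fin n) : Y :=
  A (EuclideanSpace.single j 1)

end ConicSystem

end

open scoped InnerProductSpace

namespace ConicSystem

/-! Let V be the span of b and the columns of A. A dual solution for c may be replaced by any y' in
K* with y' − y ∈ Vᗮ, since neither `A*y` nor ⟨b, y⟩ changes. So the question is when a relaxed dual
solution can be moved into K* along Vᗮ.

If a bad v exists, choose y supported on block j with y_j ⟂ z_j and ⟨y_j, v_j⟩ < 0. Maximality of z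
forces block j of every slack into lin{z_j} (`IsMaximumSlack.block_mem_span`), so the objective A*y
is constant on P. An attaining y' ∈ K* agrees with y on V, hence is orthogonal to z and negative on
v. This contradicts `inner_nonneg_of_tangent`: v is in the closure of the feasible directions at z.

If no bad v exists, duality over the minimal face F of z always attains
(`exists_mem_dualCone_minimalFace`), with some y ∈ F*. Split off y₁ ∈ K* carrying the pairing of y
with z on R and all of y on interior blocks. The rest must lie in Vᗮ + E, where E ⊆ K* ∩ zᗮ is built
from K_i* on O and the rays of z_i^△ on R. By `exists_add_of_orthogonality` it suffices to test each
v ∈ V in the dual of E. Such a v is a feasible direction at z, hence by maximality a reversible one,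
so it vanishes on O and lies in lin{z_i} on R; this kills all the pairings.

The geometry of the p-cone enters through strict Hölder (`mem_span_of_inner_conjugateVector_le`) and
the derivative of the defining inequality (`exists_add_smul_mem_pCone`). -/

/-! ### Proper separation of convex sets, and relative interiors -/

/-- Proper separation of the origin from a spanning convex set in finite dimensions. -/
theorem exists_proper_separation_zero {E : Type*} [NormedAddCommGroup E] [NormedSpace ℝ E]
    [FiniteDimensional ℝ E] {s : Set E} (hs : Convex ℝ s) (hne : s.Nonempty)
    (hspan : Submodule.span ℝ s = ⊤) (h0 : (0 : E) ∉ s) :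
    ∃ f : E →L[ℝ] ℝ, (∀ w ∈ s, f w ≤ 0) ∧ ∃ w ∈ s, f w < 0 := by
  -- Since s spans, adjoining 0 gives a hull with nonempty interior, so the Hahn–Banach theorem for
  -- open sets applies.
  have hint : (interior (convexHull ℝ (insert 0 s))).Nonempty := by
    rw [interior_convexHull_nonempty_iff_affineSpan_eq_top]
    apply SetLike.coe_injective
    rw [affineSpan_insert_zero, hspan]
    rfl
  have hmem : ∀ x ∈ convexHull ℝ (insert 0 s), ∃ a : ℝ, 0 ≤ a ∧ ∃ w ∈ s, x = a • w := by
    intro x hx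
    rw [convexHull_insert hne, hs.convexHull_eq, mem_convexJoin] at hx
    obtain ⟨y, hy, w, hw, hx⟩ := hx
    rw [Set.mem_singleton_iff] at hy
    subst hy
    obtain ⟨a, c, ha, hc, -, rfl⟩ := hx
    exact ⟨c, hc, w, hw, by simp⟩
  -- Otherwise -e • w = a • w' with e > 0, a ≥ 0 and w, w' ∈ s, which makes 0 a convex combination
  -- of w and w'.
  have h0int : (0 : E) ∉ interior (convexHull ℝ (insert 0 s)) := by
    intro h
    obtain ⟨w, hw⟩ := hne
    have hc : Continuous fun e : ℝ => (-e) • w := by fun_prop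
    have h1 : ∀ᶠ e : ℝ in nhds 0, (-e) • w ∈ interior (convexHull ℝ (insert 0 s)) :=
      hc.continuousAt.eventually (by
        simpa using isOpen_interior.mem_nhds h)
    obtain ⟨e, he, he0⟩ := ((h1.filter_mono nhdsWithin_le_nhds).and
      (self_mem_nhdsWithin : Set.Ioi (0 : ℝ) ∈ nhdsWithin 0 (Set.Ioi 0))).exists
    obtain ⟨a, ha, w', hw', hE⟩ := hmem _ (interior_subset he)
    have he0 : 0 < e := he0
    apply h0
    have hcv := hs hw hw' (a := e / (e + a)) (b := a / (e + a)) (by positivity) (by positivity)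
      (by field_simp)
    convert hcv using 1
    rw [div_eq_inv_mul, div_eq_inv_mul, mul_smul, mul_smul, ← smul_add, ← hE]
    simp
  obtain ⟨f, hf⟩ := geometric_hahn_banach_open_point
    (convex_convexHull ℝ (insert (0 : E) s)).interior isOpen_interior h0int
  simp only [map_zero] at hf
  refine ⟨f, fun w hw => ?_, ?_⟩
  · have hcl : w ∈ closure (interior (convexHull ℝ (insert 0 s))) := by
      rw [(convex_convexHull ℝ _).closure_interior_eq_closure_of_nonempty_interior hint]
      exact subset_closure (subset_convexHull ℝ _ (Set.mem_insert_of_mem _ hw))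
    exact closure_minimal (fun x hx => (hf x hx).le)
      (isClosed_le f.continuous continuous_const) hcl
  · obtain ⟨x, hx⟩ := hint
    obtain ⟨a, ha, w, hw, rfl⟩ := hmem x (interior_subset hx)
    refine ⟨w, hw, ?_⟩
    have := hf _ hx
    simp only [map_smul, smul_eq_mul] at this
    by_contra! h
    nlinarith [mul_nonneg ha h]

/-- Proper separation of a point from a convex set in finite dimensions. -/
theorem exists_proper_separation_of_convex {E : Type*} [NormedAddCommGroup E] [NormedSpace ℝ E]
    [FiniteDimensional ℝ E] {s : Set E} (hs : Convex ℝ s) (hne : s.Nonempty) {q : E}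
    (hq : q ∉ s) :
    ∃ f : E →L[ℝ] ℝ, (∀ w ∈ s, f w ≤ f q) ∧ ∃ w ∈ s, f w < f q := by
  -- Passing to the span of s - q makes the translated set spanning; the functional found there is
  -- extended back to E.
  let H := Submodule.span ℝ ((fun x => x - q) '' s)
  let s' : Set H := {x | (x : E) + q ∈ s}
  have himg : H.subtype '' s' = (fun x => x - q) '' s := by
    ext x
    constructor
    · rintro ⟨y, hy, rfl⟩
      exact ⟨_, hy, by simp⟩
    · rintro ⟨y, hy, rfl⟩
      exact ⟨⟨y - q, Submodule.subset_span ⟨y, hy, rfl⟩⟩, by simpa [s'] using hy, rfl⟩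
  have hspan : Submodule.span ℝ s' = ⊤ := by
    apply Submodule.map_injective_of_injective H.injective_subtype
    rw [Submodule.map_span, himg, Submodule.map_subtype_top]
  have hcv : Convex ℝ s' := by
    have h1 := (hs.translate_preimage_left q).linear_preimage H.subtype
    exact h1
  obtain ⟨w, hw⟩ := hne
  have hmem : ∀ w ∈ s, ∃ h : w - q ∈ H, (⟨w - q, h⟩ : H) ∈ s' := fun w hw =>
    ⟨Submodule.subset_span ⟨w, hw, rfl⟩, by simpa [s'] using hw⟩
  obtain ⟨f, hf, x, hx, hfx⟩ := exists_proper_separation_zero hcv ⟨_, (hmem w hw).2⟩ hspan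
    (by simpa [s'] using hq)
  obtain ⟨g, hg, -⟩ := exists_extension_norm_eq H f
  refine ⟨g, fun w hw => ?_, x + q, hx, ?_⟩
  · have := hf _ (hmem w hw).2
    rw [← hg, map_sub] at this
    linarith
  · rw [← hg] at hfx
    rw [map_add]
    linarith

/-- The line through s and z stays in the affine span, where z is an interior point, so the segment
from s can be prolonged past z. Apart from membership, this is all that is used about maximum
slacks. -/
theorem exists_add_smul_sub_mem_of_mem_intrinsicInterior {E : Type*} [NormedAddCommGroup E]
    [NormedSpace ℝ E] {S : Set E} {z s : E} (hz : z ∈ intrinsicInterior ℝ S) (hs : s ∈ S) :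
    ∃ ε : ℝ, 0 < ε ∧ z + ε • (z - s) ∈ S := by
  obtain ⟨z', hz', rfl⟩ := hz
  let path : ℝ → affineSpan ℝ S := fun e => ⟨AffineMap.lineMap (z' : E) s (-e),
    AffineMap.lineMap_mem _ z'.2 (subset_affineSpan ℝ S hs)⟩
  have hc : Continuous path := by
    refine Continuous.subtype_mk ?_ _
    simp only [AffineMap.lineMap_apply]
    fun_prop
  have h0 : path 0 = z' := by
    ext
    simp [path]
  have h1 : ∀ᶠ e : ℝ in nhds 0, path e ∈ interior ((↑) ⁻¹' S : Set (affineSpan ℝ S)) :=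
    hc.continuousAt.eventually (by simpa [h0] using isOpen_interior.mem_nhds hz')
  obtain ⟨e, he, he0⟩ := ((h1.filter_mono nhdsWithin_le_nhds).and
    (self_mem_nhdsWithin : Set.Ioi (0 : ℝ) ∈ nhdsWithin 0 (Set.Ioi 0))).exists
  refine ⟨e, he0, ?_⟩
  have := interior_subset he
  rw [Set.mem_preimage] at this
  convert this using 1
  simp only [path, AffineMap.lineMap_apply, vsub_eq_sub, vadd_eq_add]
  module

/-! ### Geometry of a single p-cone -/

section PCone

variable {p : ℝ} {k : ℕ}

theorem sum_abs_rpow_nonneg (p : ℝ) (x : Fin k → ℝ) : 0 ≤ ∑ i, |x i| ^ p :=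
  Finset.sum_nonneg fun _ _ => Real.rpow_nonneg (abs_nonneg _) _

theorem pNorm_nonneg (p : ℝ) (x : Fin k → ℝ) : 0 ≤ pNorm p x :=
  Real.rpow_nonneg (sum_abs_rpow_nonneg p x) _

theorem pNorm_rpow (hp : 1 < p) (x : Fin k → ℝ) : pNorm p x ^ p = ∑ i, |x i| ^ p := by
  rw [pNorm, ← Real.rpow_mul (sum_abs_rpow_nonneg p x), one_div_mul_cancel (by linarith),
    Real.rpow_one]

theorem mem_pCone_iff (hp : 1 < p) (w : EuclideanSpace ℝ (Fin (k + 1))) :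
    w ∈ pCone p k ↔ 0 ≤ w 0 ∧ ∑ i : Fin k, |w i.succ| ^ p ≤ w 0 ^ p := by
  rw [← pNorm_rpow hp]
  constructor
  · intro h
    exact ⟨(pNorm_nonneg _ _).trans h,
      Real.rpow_le_rpow (pNorm_nonneg _ _) h (by linarith)⟩
  · rintro ⟨h0, h⟩
    exact (Real.rpow_le_rpow_iff (pNorm_nonneg _ _) h0 (by linarith)).1 h

theorem coord_zero_nonneg {w : EuclideanSpace ℝ (Fin (k + 1))} (hw : w ∈ pCone p k) : 0 ≤ w 0 :=
  (pNorm_nonneg _ _).trans hw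

theorem pCone_add_mem (hp : 1 < p) {v w : EuclideanSpace ℝ (Fin (k + 1))}
    (hv : v ∈ pCone p k) (hw : w ∈ pCone p k) : v + w ∈ pCone p k := by
  have h := Real.Lp_add_le Finset.univ (fun i : Fin k => v i.succ) (fun i : Fin k => w i.succ)
    hp.le
  exact h.trans (add_le_add hv hw)

theorem pCone_smul_mem (hp : 1 < p) {w : EuclideanSpace ℝ (Fin (k + 1))} {a : ℝ} (ha : 0 ≤ a)
    (hw : w ∈ pCone p k) : a • w ∈ pCone p k := by
  rw [mem_pCone_iff hp] at hw ⊢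
  refine ⟨mul_nonneg ha hw.1, ?_⟩
  simp only [PiLp.smul_apply, smul_eq_mul, abs_mul, abs_of_nonneg ha]
  rw [Real.mul_rpow ha hw.1]
  simp_rw [Real.mul_rpow ha (abs_nonneg _)]
  rw [← Finset.mul_sum]
  exact mul_le_mul_of_nonneg_left hw.2 (Real.rpow_nonneg ha _)

theorem pNorm_eq_zero_iff (hp : 1 < p) {x : Fin k → ℝ} : pNorm p x = 0 ↔ x = 0 := by
  constructor
  · intro h
    have h1 := pNorm_rpow hp x
    rw [h, Real.zero_rpow (by linarith), eq_comm,
      Finset.sum_eq_zero_iff_of_nonneg (fun _ _ => Real.rpow_nonneg (abs_nonneg _) _)] at h1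
    ext i
    have := h1 i (Finset.mem_univ i)
    rwa [Real.rpow_eq_zero (abs_nonneg _) (by linarith), abs_eq_zero] at this
  · rintro rfl
    have : p⁻¹ ≠ 0 := by positivity
    simp [pNorm, Real.zero_rpow (by linarith : p ≠ 0), Real.zero_rpow this]

theorem zero_mem_pCone (hp : 1 < p) : (0 : EuclideanSpace ℝ (Fin (k + 1))) ∈ pCone p k := by
  rw [mem_pCone_iff hp]
  simp [Real.zero_rpow (by linarith : p ≠ 0)]

theorem eq_zero_of_coord_zero_eq_zero (hp : 1 < p) {w : EuclideanSpace ℝ (Fin (k + 1))}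
    (hw : w ∈ pCone p k) (h0 : w 0 = 0) : w = 0 := by
  have h1 : (fun i : Fin k => w i.succ) = 0 :=
    (pNorm_eq_zero_iff hp).1 (le_antisymm (h0 ▸ hw) (pNorm_nonneg _ _))
  ext i
  refine Fin.cases h0 (fun j => congrFun h1 j) i

theorem eq_zero_of_mem_of_neg_mem (hp : 1 < p) {w : EuclideanSpace ℝ (Fin (k + 1))}
    (hw : w ∈ pCone p k) (hw' : -w ∈ pCone p k) : w = 0 := by
  refine eq_zero_of_coord_zero_eq_zero hp hw (le_antisymm ?_ (coord_zero_nonneg hw))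
  have := coord_zero_nonneg hw'
  simpa using this

theorem continuous_pNorm (hp : 1 < p) : Continuous (pNorm p : (Fin k → ℝ) → ℝ) := by
  have h : 0 ≤ 1 / p := by positivity
  unfold pNorm
  refine Continuous.rpow_const (continuous_finsetSum _ fun i _ => ?_) (fun _ => Or.inr h)
  exact Continuous.rpow_const (by fun_prop) (fun _ => Or.inr (by linarith))

theorem coord_zero_eq_of_mem_frontier (hp : 1 < p) {w : EuclideanSpace ℝ (Fin (k + 1))}
    (hw : w ∈ pCone p k) (hf : w ∈ frontier (pCone p k)) :
    w 0 = pNorm p (fun i : Fin k => w i.succ) := by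
  by_contra hne
  have hlt : pNorm p (fun i : Fin k => w i.succ) < w 0 := lt_of_le_of_ne hw (Ne.symm hne)
  have hopen : IsOpen {w : EuclideanSpace ℝ (Fin (k + 1)) |
      pNorm p (fun i : Fin k => w i.succ) < w 0} :=
    isOpen_lt ((continuous_pNorm hp).comp (by fun_prop)) (by fun_prop)
  have hsub : {w : EuclideanSpace ℝ (Fin (k + 1)) |
      pNorm p (fun i : Fin k => w i.succ) < w 0} ⊆ pCone p k :=
    fun v (hv : pNorm p (fun i : Fin k => v i.succ) < v 0) => hv.le
  exact hf.2 (interior_maximal hsub hopen hlt)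

/-- This is the form in which the derivative of |·|^p appears; at a zero coordinate the factor `x i`
makes the value of the power irrelevant. -/
theorem dualDirection_eq (p : ℝ) (x : Fin k → ℝ) (i : Fin k) :
    dualDirection p x i = |x i| ^ (p - 2) * x i := by
  unfold dualDirection
  rcases eq_or_ne (x i) 0 with h | h
  · simp [h]
  · rw [show p - 1 = (p - 2) + 1 by ring, Real.rpow_add_one (abs_ne_zero.2 h), ← mul_assoc,
      mul_comm (Real.sign _), mul_assoc]
    congr 1
    rcases lt_or_gt_of_ne h with h | h
    · rw [Real.sign_of_neg h, abs_of_neg h]; ring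
    · rw [Real.sign_of_pos h, abs_of_pos h]; ring

theorem dualDirection_mul_self (hp : 1 < p) (x : Fin k → ℝ) (i : Fin k) :
    dualDirection p x i * x i = |x i| ^ p := by
  rw [dualDirection_eq]
  rcases eq_or_ne (x i) 0 with h | h
  · simp [h, Real.zero_rpow (by linarith : p ≠ 0)]
  · rw [mul_assoc, ← abs_mul_abs_self, ← mul_assoc, ← Real.rpow_add_one (abs_ne_zero.2 h),
      ← Real.rpow_add_one (abs_ne_zero.2 h)]
    ring_nf

/-- Because (p - 1)q = p and 1/q = (p - 1)/p. It removes q from all later computations. -/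
theorem pNorm_dualDirection (hp : 1 < p) (x : Fin k → ℝ) :
    pNorm (Real.conjExponent p) (dualDirection p x) = pNorm p x ^ (p - 1) := by
  have hq : Real.conjExponent p = p / (p - 1) := rfl
  have hp1 : p - 1 ≠ 0 := by linarith
  have hp0 : p ≠ 0 := by linarith
  have hterm : ∀ i, |dualDirection p x i| ^ (Real.conjExponent p) = |x i| ^ p := by
    intro i
    rw [dualDirection, abs_mul, Real.abs_rpow_of_nonneg (abs_nonneg _), abs_abs]
    rcases eq_or_ne (x i) 0 with h | h
    · simp [h, hq, Real.zero_rpow hp0, Real.zero_rpow (div_ne_zero hp0 hp1)]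
    · have hs : |Real.sign (x i)| = 1 := by
        rcases Real.sign_apply_eq_of_ne_zero _ h with h | h <;> simp [h]
      rw [hs, one_mul, ← Real.rpow_mul (abs_nonneg _), hq, mul_div_cancel₀ _ hp1]
  unfold pNorm
  simp_rw [hterm]
  rw [← Real.rpow_mul (sum_abs_rpow_nonneg p x), hq]
  congr 1
  field_simp

theorem inner_conjugateVector (hp : 1 < p) (v w : EuclideanSpace ℝ (Fin (k + 1))) :
    inner ℝ v (conjugateVector p w) = pNorm p (fun i : Fin k => w i.succ) ^ (p - 1) * v 0
      - ∑ i, dualDirection p (fun i : Fin k => w i.succ) i * v i.succ := by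
  rw [PiLp.inner_apply, Fin.sum_univ_succ, conjugateVector]
  simp [pNorm_dualDirection hp, Finset.sum_neg_distrib, sub_eq_add_neg]

theorem bernoulli_rpow (hp : 1 < p) {u : ℝ} (hu : u ≠ 1) : 1 + p * (u - 1) < |u| ^ p := by
  rcases le_or_gt 0 u with h | h
  · have := one_add_mul_self_lt_rpow_one_add (s := u - 1) (by linarith)
      (sub_ne_zero.2 hu) hp
    rw [abs_of_nonneg h]
    rwa [add_sub_cancel] at this
  · have := Real.rpow_pos_of_pos (abs_pos.2 h.ne) p
    nlinarith

/-- Strict convexity of |·|^p: its graph lies above the tangent at t. For t ≠ 0, dividing by |t|^p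
reduces it to Bernoulli's inequality at s / t. -/
theorem abs_rpow_tangent_lt (hp : 1 < p) {s t : ℝ} (h : s ≠ t) :
    |t| ^ p + p * (|t| ^ (p - 2) * t) * (s - t) < |s| ^ p := by
  rcases eq_or_ne t 0 with rfl | ht
  · have := Real.rpow_pos_of_pos (abs_pos.2 h) p
    simpa [Real.zero_rpow (by linarith : p ≠ 0)] using this
  · have hb := bernoulli_rpow hp (u := s / t) (by rwa [Ne, div_eq_one_iff_eq ht])
    have htp := Real.rpow_pos_of_pos (abs_pos.2 ht) p
    rw [abs_div, Real.div_rpow (abs_nonneg _) (abs_nonneg _), lt_div_iff₀ htp] at hb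
    have hpow : |t| ^ p = |t| ^ (p - 2) * t * t := by
      rw [mul_assoc, ← abs_mul_abs_self, ← mul_assoc, ← Real.rpow_add_one (abs_ne_zero.2 ht),
        ← Real.rpow_add_one (abs_ne_zero.2 ht)]
      ring_nf
    calc |t| ^ p + p * (|t| ^ (p - 2) * t) * (s - t) = (1 + p * (s / t - 1)) * |t| ^ p := by
          rw [hpow]
          field_simp
      _ < |s| ^ p := hb

/-- Sum the tangent inequalities at the x_i; a coordinate where w and x differ makes the sum strict.
This is strict Hölder on a ball of the p-norm. -/
theorem sum_dualDirection_mul_lt (hp : 1 < p) {x w : Fin k → ℝ} (h : w ≠ x)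
    (hxw : ∑ i, |w i| ^ p ≤ ∑ i, |x i| ^ p) :
    ∑ i, dualDirection p x i * w i < ∑ i, |x i| ^ p := by
  have hle : ∀ i, |x i| ^ p + p * dualDirection p x i * (w i - x i) ≤ |w i| ^ p := by
    intro i
    rcases eq_or_ne (w i) (x i) with h | h
    · rw [h]; simp
    · rw [dualDirection_eq]; exact (abs_rpow_tangent_lt hp h).le
  obtain ⟨j, hj⟩ := Function.ne_iff.1 h
  have hlt : |x j| ^ p + p * dualDirection p x j * (w j - x j) < |w j| ^ p := by
    rw [dualDirection_eq]; exact abs_rpow_tangent_lt hp hj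
  have hsum := Finset.sum_lt_sum (fun i _ => hle i) ⟨j, Finset.mem_univ j, hlt⟩
  rw [Finset.sum_add_distrib] at hsum
  have hE : ∑ i, p * dualDirection p x i * (w i - x i) =
      p * (∑ i, dualDirection p x i * w i - ∑ i, |x i| ^ p) := by
    rw [← Finset.sum_sub_distrib, Finset.mul_sum]
    refine Finset.sum_congr rfl fun i _ => ?_
    rw [← dualDirection_mul_self hp]
    ring
  rw [hE] at hsum
  have hneg : p * (∑ i, dualDirection p x i * w i - ∑ i, |x i| ^ p) < 0 := by linarith
  have := neg_of_mul_neg_right hneg (by linarith)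
  linarith

/-- The equality case of Hölder's inequality for the pairing with the conjugate vector. -/
theorem mem_span_of_inner_conjugateVector_le (hp : 1 < p)
    {w z : EuclideanSpace ℝ (Fin (k + 1))} (hz : z 0 = pNorm p (fun i : Fin k => z i.succ))
    (hz0 : z ≠ 0) (hw : w ∈ pCone p k) (h : inner ℝ w (conjugateVector p z) ≤ 0) :
    w ∈ Submodule.span ℝ {z} := by
  have hzK : z ∈ pCone p k := hz.ge
  have hzpos : 0 < z 0 := lt_of_le_of_ne (coord_zero_nonneg hzK) fun h =>
    hz0 (eq_zero_of_coord_zero_eq_zero hp hzK h.symm)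
  rcases eq_or_ne (w 0) 0 with hw0 | hw0
  · rw [eq_zero_of_coord_zero_eq_zero hp hw hw0]
    exact zero_mem _
  have hwpos : 0 < w 0 := lt_of_le_of_ne (coord_zero_nonneg hw) hw0.symm
  have hsum : z 0 ^ p = ∑ i : Fin k, |z i.succ| ^ p := by rw [hz, pNorm_rpow hp]
  -- Rescaling w by a matches its first coordinate with that of z, so the tail of a • w has p-norm
  -- at most that of z.
  set a := z 0 / w 0 with ha
  have hapos : 0 < a := div_pos hzpos hwpos
  have haw : a * w 0 = z 0 := div_mul_cancel₀ _ hw0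
  have haK := (mem_pCone_iff hp _).1 (pCone_smul_mem hp hapos.le hw)
  by_contra hspan
  have hne : (fun i : Fin k => (a • w) i.succ) ≠ fun i => z i.succ := by
    intro heq
    apply hspan
    rw [Submodule.mem_span_singleton]
    refine ⟨a⁻¹, ?_⟩
    rw [inv_smul_eq_iff₀ hapos.ne']
    ext i
    refine Fin.cases ?_ (fun j => (congrFun heq j).symm) i
    simp [haw]
  have h1 := sum_dualDirection_mul_lt hp hne (by
    refine haK.2.trans ?_
    rw [← hsum]
    simp [haw])
  rw [inner_conjugateVector hp, ← hz] at h
  rw [← hsum] at h1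
  simp only [PiLp.smul_apply, smul_eq_mul] at h1
  have h2 : ∑ i : Fin k, dualDirection p (fun i => z i.succ) i * (a * w i.succ) =
      a * ∑ i : Fin k, dualDirection p (fun i => z i.succ) i * w i.succ := by
    rw [Finset.mul_sum]
    exact Finset.sum_congr rfl fun i _ => by ring
  have h3 : z 0 ^ p = a * (z 0 ^ (p - 1) * w 0) := by
    rw [mul_left_comm, haw, ← Real.rpow_add_one hzpos.ne', sub_add_cancel]
  rw [h2, h3] at h1
  have := lt_of_mul_lt_mul_left h1 hapos.le
  linarith

theorem inner_conjugateVector_self (hp : 1 < p)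
    {z : EuclideanSpace ℝ (Fin (k + 1))} (hz : z 0 = pNorm p (fun i : Fin k => z i.succ)) :
    inner ℝ z (conjugateVector p z) = 0 := by
  rw [inner_conjugateVector hp, Finset.sum_congr rfl
    (fun i _ => dualDirection_mul_self hp (fun i => z i.succ) i), ← pNorm_rpow hp, ← hz]
  have h0 : 0 ≤ z 0 := hz ▸ pNorm_nonneg _ _
  rcases eq_or_ne (z 0) 0 with h | h
  · simp [h, Real.zero_rpow (by linarith : p ≠ 0)]
  · rw [← Real.rpow_add_one h, sub_add_cancel, sub_self]

/-- By the equality case, a negative pairing would put w on the line of z, where the pairing is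
zero. -/
theorem conjugateVector_mem_dualCone (hp : 1 < p)
    {z : EuclideanSpace ℝ (Fin (k + 1))} (hz : z 0 = pNorm p (fun i : Fin k => z i.succ))
    (hz0 : z ≠ 0) : conjugateVector p z ∈ dualCone (pCone p k) := by
  intro w hw
  by_contra! h
  rw [real_inner_comm] at h
  obtain ⟨a, rfl⟩ := Submodule.mem_span_singleton.1
    (mem_span_of_inner_conjugateVector_le hp hz hz0 hw h.le)
  rw [real_inner_smul_left, inner_conjugateVector_self hp hz] at h
  simp at h

theorem apex_mem_dualCone :
    EuclideanSpace.single (0 : Fin (k + 1)) (1 : ℝ) ∈ dualCone (pCone p k) := by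
  intro w hw
  rw [EuclideanSpace.inner_single_left]
  simpa using coord_zero_nonneg hw

theorem inner_apex_conjugateVector_pos (hp : 1 < p) {z : EuclideanSpace ℝ (Fin (k + 1))}
    (hz : z 0 = pNorm p (fun i : Fin k => z i.succ)) (hz0 : z ≠ 0) :
    0 < inner ℝ (EuclideanSpace.single (0 : Fin (k + 1)) (1 : ℝ)) (conjugateVector p z) := by
  have hzK : z ∈ pCone p k := hz.ge
  have hzpos : 0 < z 0 := lt_of_le_of_ne (coord_zero_nonneg hzK) fun h =>
    hz0 (eq_zero_of_coord_zero_eq_zero hp hzK h.symm)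
  rw [inner_conjugateVector hp, ← hz]
  simpa using Real.rpow_pos_of_pos hzpos _

/-- The bidual of the cone is the cone. If w_0 were below the norm N of the tail, the conjugate
vector of the boundary point (N; tail) would pair with w to N^(p-1)(w_0 - N) < 0. -/
theorem mem_pCone_of_forall_dualCone (hp : 1 < p) {w : EuclideanSpace ℝ (Fin (k + 1))}
    (h : ∀ y ∈ dualCone (pCone p k), 0 ≤ inner ℝ y w) : w ∈ pCone p k := by
  have h0 := h _ apex_mem_dualCone
  rw [EuclideanSpace.inner_single_left] at h0
  simp only [map_one, one_mul] at h0
  by_contra! hlt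
  replace hlt : w 0 < pNorm p (fun i : Fin k => w i.succ) := not_le.1 hlt
  set N := pNorm p (fun i : Fin k => w i.succ) with hN
  have hNpos : 0 < N := h0.trans_lt hlt
  let z : EuclideanSpace ℝ (Fin (k + 1)) :=
    WithLp.toLp 2 (Fin.cons N (fun i : Fin k => w i.succ) : Fin (k + 1) → ℝ)
  have hz : z 0 = pNorm p (fun i : Fin k => z i.succ) := by simp [z, hN]
  have hz0 : z ≠ 0 := by
    intro h
    have : z 0 = 0 := by rw [h]; rfl
    exact hNpos.ne' (by simpa [z] using this)
  have h1 := h _ (conjugateVector_mem_dualCone hp hz hz0)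
  have h2 := inner_conjugateVector_self hp hz
  rw [real_inner_comm, inner_conjugateVector hp] at h1
  rw [inner_conjugateVector hp] at h2
  have e1 : (fun i : Fin k => z i.succ) = fun i => w i.succ := by ext; simp [z]
  have e2 : z 0 = N := by simp [z]
  have e3 : ∀ i : Fin k, z i.succ = w i.succ := fun i => by simp [z]
  rw [e1, ← hN] at h1
  simp only [e3, e2, ← hN] at h2
  have := Real.rpow_pos_of_pos hNpos (p - 1)
  nlinarith

/-- The difference of p-th powers defining the cone vanishes at z and has derivative p⟨v, z^△⟩ > 0
along v, so small steps enter the cone. -/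
theorem exists_add_smul_mem_pCone (hp : 1 < p) {v z : EuclideanSpace ℝ (Fin (k + 1))}
    (hz : z 0 = pNorm p (fun i : Fin k => z i.succ)) (hz0 : z ≠ 0)
    (hv : 0 < inner ℝ v (conjugateVector p z)) : ∃ ε : ℝ, 0 < ε ∧ z + ε • v ∈ pCone p k := by
  have hzK : z ∈ pCone p k := hz.ge
  have hzpos : 0 < z 0 := lt_of_le_of_ne (coord_zero_nonneg hzK) fun h =>
    hz0 (eq_zero_of_coord_zero_eq_zero hp hzK h.symm)
  have hline : ∀ a c : ℝ, HasDerivAt (fun e : ℝ => |a + e * c| ^ p)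
      (p * |a| ^ (p - 2) * a * c) 0 := by
    intro a c
    have h1 : HasDerivAt (fun e : ℝ => a + e * c) c 0 := by
      simpa using ((hasDerivAt_id (0 : ℝ)).mul_const c).const_add a
    have h2 := hasDerivAt_abs_rpow a hp
    have h3 : HasDerivAt (fun x : ℝ => |x| ^ p) (p * |a| ^ (p - 2) * a) (a + 0 * c) := by
      simpa using h2
    exact h3.comp (0 : ℝ) h1
  -- The absolute value on the first coordinate lets `hline` treat all coordinates alike; it is
  -- removed once that coordinate is known to stay positive.
  let f : ℝ → ℝ := fun e => |z 0 + e * v 0| ^ p - ∑ i : Fin k, |z i.succ + e * v i.succ| ^ p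
  have hf : HasDerivAt f (p * inner ℝ v (conjugateVector p z)) 0 := by
    have h := (hline (z 0) (v 0)).sub
      (HasDerivAt.fun_sum (u := Finset.univ) fun (i : Fin k) _ => hline (z i.succ) (v i.succ))
    refine h.congr_deriv ?_
    rw [inner_conjugateVector hp, ← hz, mul_sub, Finset.mul_sum]
    congr 1
    · rw [abs_of_pos hzpos, mul_assoc p, ← Real.rpow_add_one hzpos.ne',
        show p - 2 + 1 = p - 1 by ring, mul_assoc]
    · refine Finset.sum_congr rfl fun i _ => ?_
      rw [dualDirection_eq]
      ring
  have hf0 : f 0 = 0 := by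
    simp only [f, zero_mul, add_zero]
    rw [abs_of_pos hzpos, ← pNorm_rpow hp, ← hz, sub_self]
  have hpos : 0 < p * inner ℝ v (conjugateVector p z) := mul_pos (by linarith) hv
  have hev1 : ∀ᶠ e in nhdsWithin (0 : ℝ) (Set.Ioi 0), 0 < f e := by
    have := (hasDerivAt_iff_tendsto_slope.1 hf).mono_left
      (nhdsWithin_mono (0 : ℝ) (fun x (hx : 0 < x) => hx.ne' : Set.Ioi (0 : ℝ) ⊆ {0}ᶜ))
    filter_upwards [this.eventually (lt_mem_nhds hpos), self_mem_nhdsWithin] with e he he0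
    rw [slope_def_field, hf0, sub_zero, sub_zero] at he
    exact (div_pos_iff_of_pos_right he0).1 he
  have hev2 : ∀ᶠ e in nhdsWithin (0 : ℝ) (Set.Ioi 0), 0 < z 0 + e * v 0 := by
    have hc : Continuous fun e : ℝ => z 0 + e * v 0 := by fun_prop
    refine (hc.continuousAt.eventually ?_).filter_mono nhdsWithin_le_nhds
    simpa using lt_mem_nhds hzpos
  obtain ⟨e, ⟨he1, he2⟩, he0⟩ := ((hev1.and hev2).and self_mem_nhdsWithin).exists
  refine ⟨e, he0, (mem_pCone_iff hp _).2 ?_⟩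
  simp only [f, abs_of_pos he2] at he1
  simp only [PiLp.add_apply, PiLp.smul_apply, smul_eq_mul]
  exact ⟨he2.le, by linarith⟩

end PCone

theorem nonpos_of_forall_add_mul_le {a m C : ℝ} (h : ∀ l : ℝ, 0 ≤ l → a + l * m ≤ C) : m ≤ 0 := by
  by_contra! hm
  have h1 := h ((|C - a| + 1) / m) (by positivity)
  rw [div_mul_cancel₀ _ hm.ne'] at h1
  linarith [le_abs_self (C - a)]

/-! ### Duality over the minimal face, and membership in a subspace plus a cone -/

section Duality

variable {X Y : Type*}
  [NormedAddCommGroup X] [InnerProductSpace ℝ X]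
  [NormedAddCommGroup Y] [InnerProductSpace ℝ Y]

/-- The minimal face of the cone `K` that contains `z`. -/
def minimalFace (K : Set Y) (z : Y) : Set Y :=
  {s | s ∈ K ∧ ∃ ε : ℝ, 0 < ε ∧ z - ε • s ∈ K}

variable {K : Set Y} {z : Y}

theorem smul_mem_minimalFace (hsmul : ∀ s ∈ K, ∀ a : ℝ, 0 ≤ a → a • s ∈ K) (hz : z ∈ K)
    {s : Y} (hs : s ∈ minimalFace K z) {a : ℝ} (ha : 0 ≤ a) : a • s ∈ minimalFace K z := by
  obtain ⟨hsK, ε, hε, h⟩ := hs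
  refine ⟨hsmul s hsK a ha, ?_⟩
  rcases ha.eq_or_lt with rfl | ha
  · exact ⟨1, one_pos, by simpa using hz⟩
  · refine ⟨ε / a, div_pos hε ha, ?_⟩
    rwa [smul_smul, div_mul_cancel₀ _ ha.ne']

theorem add_mem_minimalFace (hadd : ∀ s ∈ K, ∀ s' ∈ K, s + s' ∈ K)
    (hsmul : ∀ s ∈ K, ∀ a : ℝ, 0 ≤ a → a • s ∈ K)
    {s s' : Y} (hs : s ∈ minimalFace K z) (hs' : s' ∈ minimalFace K z) :
    s + s' ∈ minimalFace K z := by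
  obtain ⟨hsK, ε, hε, h⟩ := hs
  obtain ⟨hsK', ε', hε', h'⟩ := hs'
  -- The convex combination of z - ε • s and z - ε' • s' whose weights give s and s' the same
  -- coefficient.
  refine ⟨hadd _ hsK _ hsK', ε * ε' / (ε + ε'), by positivity, ?_⟩
  have := hadd _ (hsmul _ h (ε' / (ε + ε')) (by positivity)) _
    (hsmul _ h' (ε / (ε + ε')) (by positivity))
  convert this using 1
  have hsum : ε' / (ε + ε') + ε / (ε + ε') = 1 := by field_simp; ring
  calc z - (ε * ε' / (ε + ε')) • (s + s')
      = (ε' / (ε + ε') + ε / (ε + ε')) • z - (ε * ε' / (ε + ε')) • (s + s') := by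
        rw [hsum, one_smul]
    _ = _ := by module

theorem self_mem_minimalFace (hsmul : ∀ s ∈ K, ∀ a : ℝ, 0 ≤ a → a • s ∈ K) (hz : z ∈ K) :
    z ∈ minimalFace K z :=
  ⟨hz, 1, one_pos, by simpa using hsmul z hz 0 le_rfl⟩

/-- A functional nonnegative on the face and nonpositive at z vanishes on it, because z - ε • s is
again in the face. -/
theorem inner_eq_zero_of_mem_minimalFace
    (hsmul : ∀ s ∈ K, ∀ a : ℝ, 0 ≤ a → a • s ∈ K)
    {y : Y} (hy : y ∈ dualCone (minimalFace K z)) (hyz : ⟪y, z⟫_ℝ ≤ 0)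
    {s : Y} (hs : s ∈ minimalFace K z) : ⟪y, s⟫_ℝ = 0 := by
  refine le_antisymm ?_ (hy s hs)
  obtain ⟨hsK, ε, hε, h⟩ := hs
  have h1 := hy _ (⟨h, 1, one_pos, by simpa using hsmul s hsK ε hε.le⟩ :
    z - ε • s ∈ minimalFace K z)
  rw [inner_sub_right, real_inner_smul_right] at h1
  by_contra! h2
  nlinarith [mul_pos hε h2]

theorem mem_span_insert_range_column {n : ℕ} (A : EuclideanSpace ℝ (Fin n) →ₗ[ℝ] Y) (b v : Y) :
    v ∈ Submodule.span ℝ (insert b (Set.range (column A))) ↔ ∃ (a : ℝ) (x : _), v = a • b + A x := by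
  have hcol : Submodule.span ℝ (Set.range (column A)) = LinearMap.range A := by
    have h1 : Set.range (column A) = A '' Set.range (EuclideanSpace.basisFun (Fin n) ℝ).toBasis := by
      rw [← Set.range_comp]
      congr 1
      ext j
      simp [column]
    rw [h1, ← Submodule.map_span, Module.Basis.span_eq, LinearMap.range_eq_map]
  rw [Submodule.mem_span_insert, hcol]
  constructor
  · rintro ⟨a, _, ⟨x, rfl⟩, rfl⟩
    exact ⟨a, x, rfl⟩
  · rintro ⟨a, x, rfl⟩
    exact ⟨a, _, ⟨x, rfl⟩, rfl⟩

theorem exists_inner_neg_of_notMem_span {v z : Y} (h : v ∉ Submodule.span ℝ {z}) :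
    ∃ y : Y, ⟪y, z⟫_ℝ = 0 ∧ ⟪y, v⟫_ℝ < 0 := by
  rw [← Submodule.orthogonal_orthogonal (Submodule.span ℝ {z}), Submodule.mem_orthogonal] at h
  push Not at h
  obtain ⟨u, hu, huv⟩ := h
  have huz : ⟪u, z⟫_ℝ = 0 :=
    (Submodule.mem_orthogonal' _ _).1 hu z (Submodule.mem_span_singleton_self z)
  rcases huv.lt_or_gt with h | h
  · exact ⟨u, huz, h⟩
  · exact ⟨-u, by rw [inner_neg_left, huz, neg_zero], by rw [inner_neg_left]; linarith⟩

variable [FiniteDimensional ℝ X] [FiniteDimensional ℝ Y]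

/-- Strong duality over the minimal face of a feasible slack, with dual attainment. -/
theorem exists_mem_dualCone_minimalFace (hadd : ∀ s ∈ K, ∀ s' ∈ K, s + s' ∈ K)
    (hsmul : ∀ s ∈ K, ∀ a : ℝ, 0 ≤ a → a • s ∈ K)
    (A : X →ₗ[ℝ] Y) (b : Y) (x₀ : X) (hz : b - A x₀ ∈ K) (c : X) (val : ℝ)
    (hval : ∀ x ∈ feasible A b K, ⟪c, x⟫_ℝ ≤ val) :
    ∃ y ∈ dualFeasible A (minimalFace K (b - A x₀)) c, ⟪b, y⟫_ℝ ≤ val := by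
  set z := b - A x₀ with hzdef
  have hzF := self_mem_minimalFace hsmul hz
  have h0F : (0 : Y) ∈ minimalFace K z := by
    simpa using smul_mem_minimalFace hsmul hz hzF le_rfl
  -- Pairs of a constraint residual and a number below the objective. A point (0, r) of G comes from
  -- a feasible x whose slack lies in the face, so (0, val) is not in G.
  let G : Set (Y × ℝ) :=
    {q | ∃ x : X, ∃ s ∈ minimalFace K z, q.1 = b - A x - s ∧ q.2 < ⟪c, x⟫_ℝ}
  have hG : Convex ℝ G := by
    rintro ⟨q1, r1⟩ ⟨x1, s1, hs1, he1, hr1⟩ ⟨q2, r2⟩ ⟨x2, s2, hs2, he2, hr2⟩ α β hα hβ hαβ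
    refine ⟨α • x1 + β • x2, α • s1 + β • s2, add_mem_minimalFace hadd hsmul
      (smul_mem_minimalFace hsmul hz hs1 hα) (smul_mem_minimalFace hsmul hz hs2 hβ), ?_, ?_⟩
    · dsimp only at he1 he2
      simp only [Prod.smul_mk, Prod.mk_add_mk, he1, he2, map_add, map_smul]
      obtain rfl : β = 1 - α := by linarith
      module
    · dsimp only at hr1 hr2
      simp only [Prod.smul_mk, Prod.mk_add_mk, smul_eq_mul, inner_add_right,
        real_inner_smul_right]
      rcases hα.eq_or_lt with rfl | hα
      · obtain rfl : β = 1 := by linarith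
        linarith
      · have := mul_lt_mul_of_pos_left hr1 hα
        have := mul_le_mul_of_nonneg_left hr2.le hβ
        linarith
  have hq : ((0 : Y), val) ∉ G := by
    rintro ⟨x, s, hs, he, hr⟩
    have hx : b - A x = s := (sub_eq_zero.1 he.symm)
    exact absurd (hval x (show b - A x ∈ K by rw [hx]; exact hs.1)) (not_le.2 hr)
  obtain ⟨g, hg, ⟨qy, qr⟩, hqG, hlt⟩ := exists_proper_separation_of_convex hG
    ⟨(b - A x₀ - z, ⟪c, x₀⟫_ℝ - 1), x₀, z, hzF, rfl, by simp⟩ hq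
  set y := (InnerProductSpace.toDual ℝ Y).symm (g.comp (ContinuousLinearMap.inl ℝ Y ℝ)) with hy
  set τ := g (0, 1) with hτ
  have hgy : ∀ (a : Y) (r : ℝ), g (a, r) = ⟪y, a⟫_ℝ + r * τ := by
    intro a r
    have h1 : ⟪y, a⟫_ℝ = g (a, 0) := by
      rw [hy, InnerProductSpace.toDual_symm_apply]; rfl
    have h2 : ((a, r) : Y × ℝ) = (a, 0) + r • (0, 1) := by simp
    rw [h1, h2, map_add, map_smul, smul_eq_mul]
  have hbase : ∀ x : X, ∀ s ∈ minimalFace K z, ∀ r < ⟪c, x⟫_ℝ,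
      ⟪y, b - A x - s⟫_ℝ + r * τ ≤ val * τ := by
    intro x s hs r hr
    have h1 := hg (b - A x - s, r) ⟨x, s, hs, rfl, hr⟩
    rw [hgy, hgy, inner_zero_right, zero_add] at h1
    exact h1
  have hτ0 : 0 ≤ τ := by
    have h1 := hbase x₀ z hzF (min ⟪c, x₀⟫_ℝ val - 1)
      (by linarith [min_le_left ⟪c, x₀⟫_ℝ val])
    rw [← hzdef, sub_self, inner_zero_right, zero_add] at h1
    by_contra! h
    nlinarith [min_le_right ⟪c, x₀⟫_ℝ val]
  have hclos : ∀ x : X, ∀ s ∈ minimalFace K z,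
      ⟪y, b - A x - s⟫_ℝ + ⟪c, x⟫_ℝ * τ ≤ val * τ := by
    intro x s hs
    refine le_of_forall_pos_le_add fun ε hε => ?_
    -- The strict bound on r is relaxed by a limit; the + 1 covers τ = 0.
    have h1 := hbase x s hs (⟪c, x⟫_ℝ - ε / (τ + 1))
      (by linarith [div_pos hε (by linarith : 0 < τ + 1)])
    have h2 : ε / (τ + 1) * τ ≤ ε := by
      rw [div_mul_eq_mul_div, div_le_iff₀ (by linarith)]
      nlinarith
    linarith
  have hyF : y ∈ dualCone (minimalFace K z) := by
    intro s hs
    have : -⟪y, s⟫_ℝ ≤ 0 := by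
      refine nonpos_of_forall_add_mul_le (a := ⟪y, z⟫_ℝ + ⟪c, x₀⟫_ℝ * τ) (C := val * τ)
        fun l hl => ?_
      have := hclos x₀ (l • s) (smul_mem_minimalFace hsmul hz hs hl)
      rw [← hzdef, inner_sub_right, real_inner_smul_right] at this
      linarith
    linarith
  have hAle : ∀ x : X, ⟪c, x⟫_ℝ * τ - ⟪y, A x⟫_ℝ ≤ 0 := by
    intro x
    refine nonpos_of_forall_add_mul_le (a := ⟪y, b⟫_ℝ) (C := val * τ) fun l hl => ?_
    have := hclos (l • x) 0 h0F
    rw [sub_zero, map_smul, inner_sub_right, real_inner_smul_right, real_inner_smul_right] at this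
    linarith
  have hA : ∀ x : X, ⟪y, A x⟫_ℝ = ⟪c, x⟫_ℝ * τ := by
    intro x
    have h1 := hAle x
    have h2 := hAle (-x)
    rw [map_neg, inner_neg_right, inner_neg_right] at h2
    linarith
  have hb : ⟪y, b⟫_ℝ ≤ val * τ := by
    have := hclos 0 0 h0F
    simpa using this
  rcases hτ0.eq_or_lt with hτ0 | hτpos
  -- A vertical hyperplane is impossible: with τ = 0, y vanishes on the range of A and on the whole
  -- face, hence at b, so g is zero on G. This contradicts properness, and is where z being in the
  -- relative interior of its own face replaces Slater's condition.
  · exfalso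
    rw [← hτ0] at hA hb
    have hyz : ⟪y, z⟫_ℝ ≤ 0 := by
      rw [hzdef, inner_sub_right, hA]
      linarith
    have hzero := fun s hs =>
      inner_eq_zero_of_mem_minimalFace hsmul hyF hyz (s := s) hs
    obtain ⟨x, s, hs, he, -⟩ := hqG
    dsimp only at he
    rw [hgy, hgy, ← hτ0, he, inner_sub_right, inner_sub_right, hA, hzero s hs,
      inner_zero_right] at hlt
    have := hzero z hzF
    rw [hzdef, inner_sub_right, hA] at this
    linarith
  · refine ⟨τ⁻¹ • y, ⟨fun s hs => ?_, ?_⟩, ?_⟩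
    · rw [real_inner_smul_left]
      exact mul_nonneg (inv_nonneg.2 hτpos.le) (hyF s hs)
    · refine ext_inner_right ℝ fun x => ?_
      rw [LinearMap.adjoint_inner_left, real_inner_smul_left, hA]
      field_simp
    · rw [real_inner_smul_right, real_inner_comm, inv_mul_le_iff₀ hτpos]
      linarith

/-- A criterion for a vector to lie in the sum of a subspace and a cone that need not be closed. -/
theorem exists_add_of_orthogonality {V : Submodule ℝ Y} {E : Set Y} (h0 : (0 : Y) ∈ E)
    (hadd : ∀ e ∈ E, ∀ e' ∈ E, e + e' ∈ E) (hsmul : ∀ e ∈ E, ∀ a : ℝ, 0 ≤ a → a • e ∈ E) {y : Y}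
    (h : ∀ v ∈ V, v ∈ dualCone E → (∀ e ∈ E, ⟪v, e⟫_ℝ = 0) ∧ ⟪v, y⟫_ℝ = 0) :
    ∃ u ∈ Vᗮ, ∃ e ∈ E, y = u + e := by
  let W : Set Y := {w | ∃ u ∈ Vᗮ, ∃ e ∈ E, w = u + e}
  by_contra hy
  replace hy : y ∉ W := hy
  have hW : Convex ℝ W := by
    rintro _ ⟨u1, hu1, e1, he1, rfl⟩ _ ⟨u2, hu2, e2, he2, rfl⟩ α β hα hβ -
    exact ⟨α • u1 + β • u2, add_mem (Submodule.smul_mem _ _ hu1) (Submodule.smul_mem _ _ hu2),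
      α • e1 + β • e2, hadd _ (hsmul _ he1 _ hα) _ (hsmul _ he2 _ hβ), by module⟩
  -- W need not be closed, so separation may fail to be strict at y; properness is what the
  -- hypothesis contradicts, since it makes v vanish on W and at y.
  obtain ⟨f, hf, w, hw, hlt⟩ := exists_proper_separation_of_convex hW
    ⟨0, 0, zero_mem _, 0, h0, by simp⟩ hy
  set v := -(InnerProductSpace.toDual ℝ Y).symm f with hv
  have hfv : ∀ a, f a = -⟪v, a⟫_ℝ := by
    intro a
    rw [hv, inner_neg_left, InnerProductSpace.toDual_symm_apply, neg_neg]
  have hWv : ∀ u ∈ Vᗮ, ∀ e ∈ E, ⟪v, y⟫_ℝ ≤ ⟪v, u + e⟫_ℝ := by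
    intro u hu e he
    have := hf _ ⟨u, hu, e, he, rfl⟩
    rw [hfv, hfv] at this
    linarith
  have huv : ∀ u ∈ Vᗮ, -⟪v, u⟫_ℝ ≤ 0 := by
    intro u hu
    refine nonpos_of_forall_add_mul_le (a := 0) (C := -⟪v, y⟫_ℝ) fun l _ => ?_
    have := hWv (l • u) (Submodule.smul_mem _ _ hu) 0 h0
    rw [add_zero, real_inner_smul_right] at this
    linarith
  have hvV : v ∈ V := by
    rw [← Submodule.orthogonal_orthogonal V, Submodule.mem_orthogonal']
    intro u hu
    have h1 := huv u hu
    have h2 := huv (-u) (neg_mem hu)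
    rw [inner_neg_right] at h2
    linarith
  have hvE : v ∈ dualCone E := by
    intro e he
    have : -⟪v, e⟫_ℝ ≤ 0 := by
      refine nonpos_of_forall_add_mul_le (a := 0) (C := -⟪v, y⟫_ℝ) fun l hl => ?_
      have := hWv 0 (zero_mem _) (l • e) (hsmul e he l hl)
      rw [zero_add, real_inner_smul_right] at this
      linarith
    linarith
  obtain ⟨hE, hvy⟩ := h v hvV hvE
  obtain ⟨u, hu, e, he, rfl⟩ := hw
  rw [hfv, hfv, hvy, inner_add_right, hE e he, (Submodule.mem_orthogonal V u).1 hu v hvV] at hlt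
  simp at hlt

end Duality

/-! ### Products of cones and directions at a maximum slack -/

section Blocks

variable {t : ℕ} {p : Fin t → ℝ} {k : Fin t → ℕ}

/-- The block vector whose `i`-th block is `w` and whose other blocks vanish. -/
noncomputable def blockSingle (i : Fin t) (w : EuclideanSpace ℝ (Fin (k i + 1))) : BlockSpace k :=
  WithLp.toLp 2 (Pi.single i w)

theorem blockSingle_same (i : Fin t) (w : EuclideanSpace ℝ (Fin (k i + 1))) :
    (blockSingle i w : BlockSpace k) i = w :=
  Pi.single_eq_same (M := fun i => EuclideanSpace ℝ (Fin (k i + 1))) i w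

theorem blockSingle_of_ne {i j : Fin t} (h : j ≠ i) (w : EuclideanSpace ℝ (Fin (k i + 1))) :
    (blockSingle i w : BlockSpace k) j = 0 :=
  Pi.single_eq_of_ne (M := fun i => EuclideanSpace ℝ (Fin (k i + 1))) h w

theorem inner_blockSingle (y : BlockSpace k) (i : Fin t) (w : EuclideanSpace ℝ (Fin (k i + 1))) :
    inner ℝ y (blockSingle i w) = inner ℝ (y i) w := by
  rw [PiLp.inner_apply, Finset.sum_eq_single i]
  · rw [blockSingle_same]
  · intro j _ hj
    rw [blockSingle_of_ne hj, inner_zero_right]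
  · simp

theorem pConeProd_add_mem (hp : ∀ i, 1 < p i) :
    ∀ s ∈ pConeProd p k, ∀ s' ∈ pConeProd p k, s + s' ∈ pConeProd p k :=
  fun _ hs _ hs' i => pCone_add_mem (hp i) (hs i) (hs' i)

theorem pConeProd_smul_mem (hp : ∀ i, 1 < p i) :
    ∀ s ∈ pConeProd p k, ∀ a : ℝ, 0 ≤ a → a • s ∈ pConeProd p k :=
  fun _ hs _ ha i => pCone_smul_mem (hp i) ha (hs i)

theorem blockSingle_mem_pConeProd (hp : ∀ i, 1 < p i) {i : Fin t}
    {w : EuclideanSpace ℝ (Fin (k i + 1))} (hw : w ∈ pCone (p i) (k i)) :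
    (blockSingle i w : BlockSpace k) ∈ pConeProd p k := by
  intro j
  rcases eq_or_ne j i with rfl | h
  · rwa [blockSingle_same]
  · rw [blockSingle_of_ne h]
    exact zero_mem_pCone (hp j)

theorem mem_dualCone_pConeProd_iff (hp : ∀ i, 1 < p i) {y : BlockSpace k} :
    y ∈ dualCone (pConeProd p k) ↔ ∀ i, y i ∈ dualCone (pCone (p i) (k i)) := by
  constructor
  · intro h i w hw
    rw [← inner_blockSingle]
    exact h _ (blockSingle_mem_pConeProd hp hw)
  · intro h s hs
    rw [PiLp.inner_apply]
    exact Finset.sum_nonneg fun i _ => h i _ (hs i)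

/-- By convexity one admissible step length makes all shorter ones admissible, so finitely many
blocks share a common step. -/
theorem eventually_add_smul_mem_pCone {q : ℝ} (hq : 1 < q) {m : ℕ}
    {z v : EuclideanSpace ℝ (Fin (m + 1))} (hz : z ∈ pCone q m)
    (h : ∃ ε : ℝ, 0 < ε ∧ z + ε • v ∈ pCone q m) :
    ∀ᶠ ε in nhdsWithin (0 : ℝ) (Set.Ioi 0), z + ε • v ∈ pCone q m := by
  obtain ⟨ε₀, hε₀, h⟩ := h
  filter_upwards [Ioo_mem_nhdsGT hε₀] with ε hε
  have := pCone_add_mem hq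
    (pCone_smul_mem hq (sub_nonneg.2 ((div_le_one hε₀).2 hε.2.le)) hz)
    (pCone_smul_mem hq (div_nonneg hε.1.le hε₀.le) h)
  convert this using 1
  rw [smul_add, smul_smul, div_mul_cancel₀ _ hε₀.ne']
  module

theorem exists_add_smul_mem_of_mem_interior {E : Type*} [NormedAddCommGroup E] [NormedSpace ℝ E]
    {s : Set E} {z : E} (hz : z ∈ interior s) (v : E) : ∃ ε : ℝ, 0 < ε ∧ z + ε • v ∈ s := by
  have hc : Continuous fun e : ℝ => z + e • v := by fun_prop
  have h1 : ∀ᶠ e : ℝ in nhds 0, z + e • v ∈ interior s :=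
    hc.continuousAt.eventually (by simpa using isOpen_interior.mem_nhds hz)
  obtain ⟨e, he, he0⟩ := ((h1.filter_mono nhdsWithin_le_nhds).and
    (self_mem_nhdsWithin : Set.Ioi (0 : ℝ) ∈ nhdsWithin 0 (Set.Ioi 0))).exists
  exact ⟨e, he0, interior_subset he⟩

theorem inner_nonneg_of_add_smul_mem {E : Type*} [NormedAddCommGroup E] [InnerProductSpace ℝ E]
    {K : Set E} {y z v : E} (hy : y ∈ dualCone K) (hyz : ⟪y, z⟫_ℝ = 0)
    (h : ∃ ε : ℝ, 0 < ε ∧ z + ε • v ∈ K) : 0 ≤ ⟪y, v⟫_ℝ := by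
  obtain ⟨ε, hε, h⟩ := h
  have := hy _ h
  rw [inner_add_right, hyz, zero_add, real_inner_smul_right] at this
  exact nonneg_of_mul_nonneg_right this hε

/-- A vector on the right side of the tangent hyperplane at `z` pairs nonnegatively with every
dual vector orthogonal to `z`. -/
theorem inner_nonneg_of_inner_conjugateVector_nonneg {q : ℝ} (hq : 1 < q) {m : ℕ}
    {y z v : EuclideanSpace ℝ (Fin (m + 1))} (hz : z 0 = pNorm q (fun i : Fin m => z i.succ))
    (hz0 : z ≠ 0) (hy : y ∈ dualCone (pCone q m)) (hyz : ⟪y, z⟫_ℝ = 0)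
    (hv : 0 ≤ inner ℝ v (conjugateVector q z)) : 0 ≤ ⟪y, v⟫_ℝ := by
  set e := EuclideanSpace.single (0 : Fin (m + 1)) (1 : ℝ)
  have he : 0 < inner ℝ e (conjugateVector q z) := inner_apex_conjugateVector_pos hq hz hz0
  -- Tilting v by δ • e makes its pairing with the conjugate vector strictly positive, so the tilted
  -- vector is a feasible direction; then δ is taken small.
  have h : ∀ δ : ℝ, 0 < δ → 0 ≤ ⟪y, v⟫_ℝ + δ * ⟪y, e⟫_ℝ := by
    intro δ hδ
    have := inner_nonneg_of_add_smul_mem hy hyz (exists_add_smul_mem_pCone hq hz hz0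
      (v := v + δ • e) (by
        rw [inner_add_left, real_inner_smul_left]
        positivity))
    rwa [inner_add_right, real_inner_smul_right] at this
  by_contra! hneg
  have h1 := h (-⟪y, v⟫_ℝ / (2 * (|⟪y, e⟫_ℝ| + 1)))
    (div_pos (by linarith) (by positivity))
  have h2 : -⟪y, v⟫_ℝ / (2 * (|⟪y, e⟫_ℝ| + 1)) * ⟪y, e⟫_ℝ ≤ -⟪y, v⟫_ℝ / 2 := by
    rw [div_mul_eq_mul_div, div_le_div_iff₀ (by positivity) two_pos]
    nlinarith [le_abs_self ⟪y, e⟫_ℝ, abs_nonneg ⟪y, e⟫_ℝ]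
  linarith

theorem IsMaximumSlack.exists_eq {X Y : Type*} [NormedAddCommGroup X] [InnerProductSpace ℝ X]
    [NormedAddCommGroup Y] [InnerProductSpace ℝ Y] {A : X →ₗ[ℝ] Y} {b z : Y} {K : Set Y}
    (hz : IsMaximumSlack A b K z) : (∃ x, z = b - A x) ∧ z ∈ K := by
  have h : z ∈ {s : Y | (∃ x, s = b - A x) ∧ s ∈ K} := intrinsicInterior_subset (𝕜 := ℝ) hz
  exact h

theorem IsMaximumSlack.exists_add_smul_sub_mem {X Y : Type*} [NormedAddCommGroup X]
    [InnerProductSpace ℝ X] [NormedAddCommGroup Y] [InnerProductSpace ℝ Y] {A : X →ₗ[ℝ] Y}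
    {b z : Y} {K : Set Y} (hz : IsMaximumSlack A b K z) {x : X} (hx : b - A x ∈ K) :
    ∃ ε : ℝ, 0 < ε ∧ z + ε • (z - (b - A x)) ∈ K := by
  obtain ⟨ε, hε, h⟩ := exists_add_smul_sub_mem_of_mem_intrinsicInterior hz
    (s := b - A x) ⟨⟨x, rfl⟩, hx⟩
  exact ⟨ε, hε, h.2⟩

/-- Directions of V that are feasible in every block are reversible at a maximum slack: z + ε • v is
a positive multiple of a slack, and the segment from that slack to z can be prolonged past z. -/
theorem IsMaximumSlack.exists_sub_smul_mem {n : ℕ} (hp : ∀ i, 1 < p i)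
    {A : EuclideanSpace ℝ (Fin n) →ₗ[ℝ] BlockSpace k} {b z v : BlockSpace k}
    (hz : IsMaximumSlack A b (pConeProd p k) z)
    (hv : v ∈ Submodule.span ℝ (insert b (Set.range (column A))))
    (h : ∀ i, ∃ ε : ℝ, 0 < ε ∧ z i + ε • v i ∈ pCone (p i) (k i)) :
    ∃ δ : ℝ, 0 < δ ∧ z - δ • v ∈ pConeProd p k := by
  obtain ⟨a, x, rfl⟩ := (mem_span_insert_range_column A b v).1 hv
  obtain ⟨⟨x₀, hx₀⟩, hzK⟩ := hz.exists_eq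
  have hev : ∀ᶠ ε in nhdsWithin (0 : ℝ) (Set.Ioi 0), z + ε • (a • b + A x) ∈ pConeProd p k :=
    Filter.eventually_all.2 fun i => eventually_add_smul_mem_pCone (hp i) (hzK i) (h i)
  have hev' : ∀ᶠ ε in nhdsWithin (0 : ℝ) (Set.Ioi 0), 0 < 1 + ε * a := by
    have hc : Continuous fun e : ℝ => 1 + e * a := by fun_prop
    refine (hc.continuousAt.eventually ?_).filter_mono nhdsWithin_le_nhds
    simpa using lt_mem_nhds one_pos
  obtain ⟨ε, ⟨h1, h2⟩, hε⟩ := ((hev.and hev').and self_mem_nhdsWithin).exists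
  replace hε : 0 < ε := hε
  set c := 1 + ε * a with hc
  -- In z + ε • v the vector b has coefficient c = 1 + ε a, so dividing by c yields a slack.
  have hs : b - A (c⁻¹ • (x₀ - ε • x)) = c⁻¹ • (z + ε • (a • b + A x)) := by
    rw [eq_inv_smul_iff₀ h2.ne', smul_sub, map_smul, smul_inv_smul₀ h2.ne', hx₀, hc, map_sub,
      map_smul]
    module
  have hsK : b - A (c⁻¹ • (x₀ - ε • x)) ∈ pConeProd p k := by
    rw [hs]
    exact pConeProd_smul_mem hp _ h1 _ (inv_nonneg.2 h2.le)
  obtain ⟨η, hη, h3⟩ := hz.exists_add_smul_sub_mem hsK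
  rw [hs] at h3
  -- Adding (η c⁻¹) • z cancels the z-part of the subtracted slack, leaving (1 + η) • z - (η c⁻¹ ε)
  -- • v.
  have h4 := pConeProd_smul_mem hp _ (pConeProd_add_mem hp _ h3 _
    (pConeProd_smul_mem hp _ hzK (η * c⁻¹) (by positivity))) (1 + η)⁻¹ (by positivity)
  refine ⟨(1 + η)⁻¹ * (η * c⁻¹ * ε), by positivity, ?_⟩
  convert h4 using 1
  rw [eq_inv_smul_iff₀ (by positivity), smul_sub, smul_smul, mul_inv_cancel_left₀ (by positivity)]
  module

end Blocks

/-! ### The two directions of the characterization -/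

section Characterization

variable {n t : ℕ} {p : Fin t → ℝ} {k : Fin t → ℕ}
  {A : EuclideanSpace ℝ (Fin n) →ₗ[ℝ] BlockSpace k} {b z v : BlockSpace k}

theorem boundary_block (hp : ∀ i, 1 < p i) (hzK : z ∈ pConeProd p k) {i : Fin t}
    (hi : z i ∈ frontier (pCone (p i) (k i)) \ {0}) :
    z i 0 = pNorm (p i) (fun l : Fin (k i) => z i l.succ) ∧ z i ≠ 0 :=
  ⟨coord_zero_eq_of_mem_frontier (hp i) (hzK i) hi.1, hi.2⟩

theorem mem_interior_of_block (hzK : z ∈ pConeProd p k) {i : Fin t} (h0 : z i ≠ 0)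
    (hi : z i ∉ frontier (pCone (p i) (k i)) \ {0}) : z i ∈ interior (pCone (p i) (k i)) := by
  rw [← self_sdiff_frontier]
  exact ⟨hzK i, fun h => hi ⟨h, h0⟩⟩

/-- The dual vectors orthogonal to `z` pair nonnegatively with the closure of the cone of
feasible directions at `z`. -/
theorem inner_nonneg_of_tangent (hp : ∀ i, 1 < p i) (hzK : z ∈ pConeProd p k)
    (hO : ∀ i, z i = 0 → v i ∈ pCone (p i) (k i))
    (hR : ∀ i, z i ∈ frontier (pCone (p i) (k i)) \ {0} →
      0 ≤ inner ℝ (v i) (conjugateVector (p i) (z i)))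
    {y : BlockSpace k} (hy : y ∈ dualCone (pConeProd p k)) (hyz : ⟪y, z⟫_ℝ = 0) :
    0 ≤ ⟪y, v⟫_ℝ := by
  rw [mem_dualCone_pConeProd_iff hp] at hy
  rw [PiLp.inner_apply, Finset.sum_eq_zero_iff_of_nonneg fun i _ => hy i _ (hzK i)] at hyz
  rw [PiLp.inner_apply]
  refine Finset.sum_nonneg fun i _ => ?_
  have hyzi := hyz i (Finset.mem_univ i)
  by_cases h0 : z i = 0
  · exact hy i _ (hO i h0)
  by_cases hi : z i ∈ frontier (pCone (p i) (k i)) \ {0}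
  · obtain ⟨h1, h2⟩ := boundary_block hp hzK hi
    exact inner_nonneg_of_inner_conjugateVector_nonneg (hp i) h1 h2 (hy i) hyzi (hR i hi)
  · exact inner_nonneg_of_add_smul_mem (hy i) hyzi
      (exists_add_smul_mem_of_mem_interior (mem_interior_of_block hzK h0 hi) _)

/-- The prolonged point z + ε(z - s) lies in K, so z_i^△ is nonnegative there; as it vanishes at
z_i, it is nonpositive at s_i, and the equality case of Hölder applies. -/
theorem IsMaximumSlack.block_mem_span (hp : ∀ i, 1 < p i)
    (hz : IsMaximumSlack A b (pConeProd p k) z) {x : EuclideanSpace ℝ (Fin n)}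
    (hx : b - A x ∈ pConeProd p k) {i : Fin t}
    (hi : z i ∈ frontier (pCone (p i) (k i)) \ {0}) :
    (b - A x) i ∈ Submodule.span ℝ {z i} := by
  obtain ⟨h1, h2⟩ := boundary_block hp hz.exists_eq.2 hi
  obtain ⟨ε, hε, h⟩ := hz.exists_add_smul_sub_mem hx
  refine mem_span_of_inner_conjugateVector_le (hp i) h1 h2 (hx i) ?_
  have h3 := conjugateVector_mem_dualCone (hp i) h1 h2 _ (h i)
  rw [real_inner_comm, PiLp.add_apply, PiLp.smul_apply, PiLp.sub_apply, inner_add_left,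
    real_inner_smul_left, inner_sub_left, inner_conjugateVector_self (hp i) h1] at h3
  by_contra! h4
  nlinarith [mul_pos hε h4]

theorem badlyBehaved_of_tangent (hp : ∀ i, 1 < p i)
    (hz : IsMaximumSlack A b (pConeProd p k) z)
    (hv : v ∈ Submodule.span ℝ (insert b (Set.range (column A))))
    (hO : ∀ i, z i = 0 → v i ∈ pCone (p i) (k i))
    (hR : ∀ i, z i ∈ frontier (pCone (p i) (k i)) \ {0} →
      0 ≤ inner ℝ (v i) (conjugateVector (p i) (z i)))
    {j : Fin t} (hj : z j ∈ frontier (pCone (p j) (k j)) \ {0})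
    (hvj : v j ∉ Submodule.span ℝ {z j}) :
    BadlyBehaved A b (pConeProd p k) := by
  intro hwb
  obtain ⟨⟨x₀, hx₀⟩, hzK⟩ := hz.exists_eq
  obtain ⟨y₁, hy₁z, hy₁v⟩ := exists_inner_neg_of_notMem_span hvj
  obtain ⟨a, x, hax⟩ := (mem_span_insert_range_column A b v).1 hv
  set y : BlockSpace k := blockSingle j y₁ with hy
  have hyinner : ∀ s : BlockSpace k, ⟪y, s⟫_ℝ = ⟪y₁, s j⟫_ℝ := fun s => by
    rw [real_inner_comm, hy, inner_blockSingle, real_inner_comm]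
  have hyslack : ∀ x ∈ feasible A b (pConeProd p k), ⟪y, A x⟫_ℝ = ⟪y, b⟫_ℝ := by
    intro x hx
    obtain ⟨l, hl⟩ := Submodule.mem_span_singleton.1 (hz.block_mem_span hp hx hj)
    have h1 : ⟪y, b - A x⟫_ℝ = 0 := by
      rw [hyinner, ← hl, real_inner_smul_right, hy₁z, mul_zero]
    rw [inner_sub_right] at h1
    linarith
  have hx₀P : x₀ ∈ feasible A b (pConeProd p k) := by
    show b - A x₀ ∈ pConeProd p k
    rwa [← hx₀]
  obtain ⟨y', ⟨hy'K, hy'A⟩, hy'b⟩ := hwb (LinearMap.adjoint A y) ⟪y, b⟫_ℝ (by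
    refine IsGreatest.isLUB ⟨⟨x₀, hx₀P, ?_⟩, ?_⟩
    · simp only [LinearMap.adjoint_inner_left, hyslack x₀ hx₀P]
    · rintro _ ⟨x, hx, rfl⟩
      simp only [LinearMap.adjoint_inner_left, hyslack x hx, le_refl])
  -- With equality at b as well, y' and y agree on all of V, in particular at z and at v.
  have hA : ∀ x, ⟪y', A x⟫_ℝ = ⟪y, A x⟫_ℝ := fun x => by
    rw [← LinearMap.adjoint_inner_left, hy'A, LinearMap.adjoint_inner_left]
  rw [real_inner_comm] at hy'b
  have hy'z : ⟪y', z⟫_ℝ = 0 := by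
    rw [hx₀, inner_sub_right, hy'b, hA, ← inner_sub_right, ← hx₀, hyinner, hy₁z]
  have h1 := inner_nonneg_of_tangent hp hzK hO hR hy'K hy'z
  rw [hax, inner_add_right, real_inner_smul_right, hy'b, hA, ← real_inner_smul_right,
    ← inner_add_right, ← hax, hyinner] at h1
  linarith

/-- On a block where z is interior, the minimal face contains the whole factor K_i. -/
theorem dual_block_of_mem_interior (hp : ∀ i, 1 < p i) (hzK : z ∈ pConeProd p k)
    {y : BlockSpace k} (hy : y ∈ dualCone (minimalFace (pConeProd p k) z)) {i : Fin t}
    (hi : z i ∈ interior (pCone (p i) (k i))) : y i ∈ dualCone (pCone (p i) (k i)) := by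
  intro w hw
  rw [← inner_blockSingle]
  obtain ⟨ε, hε, h⟩ := exists_add_smul_mem_of_mem_interior hi (-w)
  refine hy _ ⟨blockSingle_mem_pConeProd hp hw, ε, hε, fun l => ?_⟩
  rcases eq_or_ne l i with rfl | hl
  · rw [PiLp.sub_apply, PiLp.smul_apply, blockSingle_same, sub_eq_add_neg, ← smul_neg]
    exact h
  · rw [PiLp.sub_apply, PiLp.smul_apply, blockSingle_of_ne hl, smul_zero, sub_zero]
    exact hzK l

theorem inner_block_nonneg (hp : ∀ i, 1 < p i) (hzK : z ∈ pConeProd p k)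
    {y : BlockSpace k} (hy : y ∈ dualCone (minimalFace (pConeProd p k) z)) (i : Fin t) :
    0 ≤ ⟪y i, z i⟫_ℝ := by
  rw [← inner_blockSingle]
  refine hy _ ⟨blockSingle_mem_pConeProd hp (hzK i), 1, one_pos, fun l => ?_⟩
  rcases eq_or_ne l i with rfl | hl
  · rw [PiLp.sub_apply, PiLp.smul_apply, blockSingle_same, one_smul, sub_self]
    exact zero_mem_pCone (hp l)
  · rw [PiLp.sub_apply, PiLp.smul_apply, blockSingle_of_ne hl, smul_zero, sub_zero]
    exact hzK l

/-- Feasible directions at a maximum slack are lineality directions in the boundary blocks. -/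
theorem IsMaximumSlack.eq_zero_and_mem_span (hp : ∀ i, 1 < p i)
    (hz : IsMaximumSlack A b (pConeProd p k) z)
    (hno : ∀ v ∈ Submodule.span ℝ (insert b (Set.range (column A))),
      (∀ i, z i = 0 → v i ∈ pCone (p i) (k i)) →
      (∀ i, z i ∈ frontier (pCone (p i) (k i)) \ {0} →
        0 ≤ inner ℝ (v i) (conjugateVector (p i) (z i))) →
      ∀ j, z j ∈ frontier (pCone (p j) (k j)) \ {0} →
        inner ℝ (v j) (conjugateVector (p j) (z j)) = 0 → v j ∈ Submodule.span ℝ {z j})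
    (hv : v ∈ Submodule.span ℝ (insert b (Set.range (column A))))
    (hO : ∀ i, z i = 0 → v i ∈ pCone (p i) (k i))
    (hR : ∀ i, z i ∈ frontier (pCone (p i) (k i)) \ {0} →
      0 ≤ inner ℝ (v i) (conjugateVector (p i) (z i))) :
    (∀ i, z i = 0 → v i = 0) ∧
    ∀ i, z i ∈ frontier (pCone (p i) (k i)) \ {0} → v i ∈ Submodule.span ℝ {z i} := by
  have hzK := hz.exists_eq.2
  have hdir : ∀ i, ∃ ε : ℝ, 0 < ε ∧ z i + ε • v i ∈ pCone (p i) (k i) := by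
    intro i
    by_cases h0 : z i = 0
    · exact ⟨1, one_pos, by simpa [h0] using hO i h0⟩
    by_cases hi : z i ∈ frontier (pCone (p i) (k i)) \ {0}
    · obtain ⟨h1, h2⟩ := boundary_block hp hzK hi
      rcases (hR i hi).eq_or_lt with h | h
      · obtain ⟨l, hl⟩ := Submodule.mem_span_singleton.1 (hno v hv hO hR i hi h.symm)
        have hpos : 0 < |l| + 1 := by positivity
        -- Here v_i = l • z_i, and this step length keeps the factor 1 + ε l nonnegative.
        refine ⟨(|l| + 1)⁻¹, inv_pos.2 hpos, ?_⟩
        have hnn : 0 ≤ 1 + (|l| + 1)⁻¹ * l := by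
          rw [inv_mul_eq_div, ← sub_neg_eq_add, ← neg_div, sub_nonneg, div_le_one hpos]
          linarith [neg_abs_le l]
        have := pCone_smul_mem (hp i) hnn (hzK i)
        rwa [add_smul, one_smul, mul_smul, hl] at this
      · exact exists_add_smul_mem_pCone (hp i) h1 h2 h
    · exact exists_add_smul_mem_of_mem_interior (mem_interior_of_block hzK h0 hi) _
  obtain ⟨δ, hδ, h⟩ := hz.exists_sub_smul_mem hp hv hdir
  constructor
  · intro i h0
    refine eq_zero_of_mem_of_neg_mem (hp i) (hO i h0) ?_
    have h1 := pCone_smul_mem (hp i) (inv_nonneg.2 hδ.le) (h i)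
    rwa [PiLp.sub_apply, PiLp.smul_apply, h0, zero_sub, smul_neg, inv_smul_smul₀ hδ.ne'] at h1
  · intro i hi
    obtain ⟨h1, h2⟩ := boundary_block hp hzK hi
    refine hno v hv hO hR i hi (le_antisymm ?_ (hR i hi))
    have h3 := conjugateVector_mem_dualCone (hp i) h1 h2 _ (h i)
    rw [real_inner_comm, PiLp.sub_apply, PiLp.smul_apply, inner_sub_left, real_inner_smul_left,
      inner_conjugateVector_self (hp i) h1] at h3
    by_contra! h4
    nlinarith [mul_pos hδ h4]

theorem wellBehaved_of_forall_tangent (hp : ∀ i, 1 < p i)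
    (hz : IsMaximumSlack A b (pConeProd p k) z)
    (hno : ∀ v ∈ Submodule.span ℝ (insert b (Set.range (column A))),
      (∀ i, z i = 0 → v i ∈ pCone (p i) (k i)) →
      (∀ i, z i ∈ frontier (pCone (p i) (k i)) \ {0} →
        0 ≤ inner ℝ (v i) (conjugateVector (p i) (z i))) →
      ∀ j, z j ∈ frontier (pCone (p j) (k j)) \ {0} →
        inner ℝ (v j) (conjugateVector (p j) (z j)) = 0 → v j ∈ Submodule.span ℝ {z j}) :
    WellBehaved A b (pConeProd p k) := by
  classical
  intro c val hval
  obtain ⟨⟨x₀, hx₀⟩, hzK⟩ := hz.exists_eq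
  have hadd := pConeProd_add_mem (k := k) hp
  have hsmul := pConeProd_smul_mem (k := k) hp
  obtain ⟨y, ⟨hyF, hyA⟩, hyb⟩ := exists_mem_dualCone_minimalFace hadd hsmul A b x₀ (hx₀ ▸ hzK) c val
    fun x hx => hval.1 ⟨x, hx, rfl⟩
  rw [← hx₀] at hyF
  let R : Set (Fin t) := {i | z i ∈ frontier (pCone (p i) (k i)) \ {0}}
  let V := Submodule.span ℝ (insert b (Set.range (column A)))
  -- Members of K* orthogonal to z. A vector lies in the dual of E exactly when it meets the
  -- conditions of the theorem on O and R.
  let E : Set (BlockSpace k) := {e | (∀ i, z i = 0 → e i ∈ dualCone (pCone (p i) (k i))) ∧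
    (∀ i ∈ R, ∃ l : ℝ, 0 ≤ l ∧ e i = l • conjugateVector (p i) (z i)) ∧
    ∀ i, z i ≠ 0 → i ∉ R → e i = 0}
  have hEK : ∀ e ∈ E, e ∈ dualCone (pConeProd p k) := by
    intro e he
    rw [mem_dualCone_pConeProd_iff hp]
    intro i
    by_cases h0 : z i = 0
    · exact he.1 i h0
    by_cases hi : i ∈ R
    · obtain ⟨l, hl, hel⟩ := he.2.1 i hi
      obtain ⟨h1, h2⟩ := boundary_block hp hzK hi
      intro w hw
      rw [hel, real_inner_smul_left]
      exact mul_nonneg hl (conjugateVector_mem_dualCone (hp i) h1 h2 w hw)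
    · intro w _
      rw [he.2.2 i h0 hi, inner_zero_left]
  have hE0 : (0 : BlockSpace k) ∈ E :=
    ⟨fun i _ w _ => by simp, fun i _ => ⟨0, le_rfl, by simp⟩, fun i _ _ => rfl⟩
  have hEadd : ∀ e ∈ E, ∀ e' ∈ E, e + e' ∈ E := by
    intro e he e' he'
    refine ⟨fun i h0 w hw => ?_, fun i hi => ?_, fun i h0 hi => ?_⟩
    · rw [PiLp.add_apply, inner_add_left]
      exact add_nonneg (he.1 i h0 w hw) (he'.1 i h0 w hw)
    · obtain ⟨l, hl, hel⟩ := he.2.1 i hi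
      obtain ⟨l', hl', hel'⟩ := he'.2.1 i hi
      exact ⟨l + l', add_nonneg hl hl', by rw [PiLp.add_apply, hel, hel', add_smul]⟩
    · rw [PiLp.add_apply, he.2.2 i h0 hi, he'.2.2 i h0 hi, add_zero]
  have hEsmul : ∀ e ∈ E, ∀ a : ℝ, 0 ≤ a → a • e ∈ E := by
    intro e he a ha
    refine ⟨fun i h0 w hw => ?_, fun i hi => ?_, fun i h0 hi => ?_⟩
    · rw [PiLp.smul_apply, real_inner_smul_left]
      exact mul_nonneg ha (he.1 i h0 w hw)
    · obtain ⟨l, hl, hel⟩ := he.2.1 i hi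
      exact ⟨a * l, mul_nonneg ha hl, by rw [PiLp.smul_apply, hel, mul_smul]⟩
    · rw [PiLp.smul_apply, he.2.2 i h0 hi, smul_zero]
  -- On R the multiple of the first unit vector is scaled so that y₁ and y pair equally with z_i;
  -- hence y - y₁ is orthogonal to z_i there and zero on interior blocks.
  let y₁ : BlockSpace k := WithLp.toLp 2 fun i =>
    if z i = 0 then 0 else if i ∈ R then
      (⟪y i, z i⟫_ℝ / z i 0) • EuclideanSpace.single (0 : Fin (k i + 1)) (1 : ℝ) else y i
  have hy₁O : ∀ i, z i = 0 → y₁ i = 0 := fun i h0 => if_pos h0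
  have hy₁R : ∀ i ∈ R, y₁ i =
      (⟪y i, z i⟫_ℝ / z i 0) • EuclideanSpace.single (0 : Fin (k i + 1)) (1 : ℝ) :=
    fun i hi => (if_neg hi.2).trans (if_pos hi)
  have hy₁I : ∀ i, z i ≠ 0 → i ∉ R → y₁ i = y i := fun i h0 hi => (if_neg h0).trans (if_neg hi)
  have hy₁K : y₁ ∈ dualCone (pConeProd p k) := by
    rw [mem_dualCone_pConeProd_iff hp]
    intro i
    by_cases h0 : z i = 0
    · intro w _
      rw [hy₁O i h0, inner_zero_left]
    by_cases hi : i ∈ R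
    · intro w hw
      rw [hy₁R i hi, real_inner_smul_left]
      exact mul_nonneg (div_nonneg (inner_block_nonneg hp hzK hyF i) (coord_zero_nonneg (hzK i)))
        (apex_mem_dualCone w hw)
    · rw [hy₁I i h0 hi]
      exact dual_block_of_mem_interior hp hzK hyF (mem_interior_of_block hzK h0 hi)
  obtain ⟨u, hu, e, he, hue⟩ := exists_add_of_orthogonality (V := V) hE0 hEadd hEsmul
    (y := y - y₁) (by
      intro v hv hvE
      obtain ⟨hvO, hvR⟩ := hz.eq_zero_and_mem_span hp hno hv
        -- Testing v against elements of E supported on a single block recovers the conditions on O,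
        -- through the bidual, and on R, through the conjugate vector itself.
        (fun i h0 => mem_pCone_of_forall_dualCone (hp i) fun w hw => by
          rw [real_inner_comm, ← inner_blockSingle]
          refine hvE _ ⟨fun l _ => ?_, fun l hl => ⟨0, le_rfl, ?_⟩, fun l hl _ => ?_⟩
          · rcases eq_or_ne l i with rfl | hli
            · rwa [blockSingle_same]
            · rw [blockSingle_of_ne hli]
              intro _ _
              rw [inner_zero_left]
          · rw [zero_smul]
            exact blockSingle_of_ne (show l ≠ i from fun h => hl.2 (by rw [h]; exact h0)) _
          · exact blockSingle_of_ne (show l ≠ i from fun h => hl (by rw [h]; exact h0)) _)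
        (fun i hi => by
          rw [← inner_blockSingle]
          refine hvE _ ⟨fun l hl => ?_, fun l hl => ?_, fun l _ hl => ?_⟩
          · rw [blockSingle_of_ne (show l ≠ i from fun h => hi.2 (by rw [← h]; exact hl))]
            intro _ _
            rw [inner_zero_left]
          · rcases eq_or_ne l i with rfl | hli
            · exact ⟨1, zero_le_one, by rw [blockSingle_same, one_smul]⟩
            · exact ⟨0, le_rfl, by rw [blockSingle_of_ne hli, zero_smul]⟩
          · exact blockSingle_of_ne (show l ≠ i from fun h => hl (by rw [h]; exact hi)) _)
      constructor
      · intro e he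
        rw [PiLp.inner_apply]
        refine Finset.sum_eq_zero fun i _ => ?_
        by_cases h0 : z i = 0
        · rw [hvO i h0, inner_zero_left]
        by_cases hi : i ∈ R
        · obtain ⟨l, -, hel⟩ := he.2.1 i hi
          obtain ⟨m, hm⟩ := Submodule.mem_span_singleton.1 (hvR i hi)
          rw [hel, ← hm, real_inner_smul_right, real_inner_smul_left,
            inner_conjugateVector_self (hp i) (boundary_block hp hzK hi).1, mul_zero, mul_zero]
        · rw [he.2.2 i h0 hi, inner_zero_right]
      · rw [PiLp.inner_apply]
        refine Finset.sum_eq_zero fun i _ => ?_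
        by_cases h0 : z i = 0
        · rw [hvO i h0, inner_zero_left]
        by_cases hi : i ∈ R
        · obtain ⟨m, hm⟩ := Submodule.mem_span_singleton.1 (hvR i hi)
          have hne : z i 0 ≠ 0 := fun h =>
            hi.2 (eq_zero_of_coord_zero_eq_zero (hp i) (hzK i) h)
          rw [PiLp.sub_apply, hy₁R i hi, ← hm, real_inner_smul_left, inner_sub_right,
            real_inner_smul_right, EuclideanSpace.inner_single_right, real_inner_comm (y i)]
          simp [hne]
        · rw [PiLp.sub_apply, hy₁I i h0 hi, sub_self, inner_zero_right])
  have hV : ∀ (a : ℝ) (x : _), ⟪u, a • b + A x⟫_ℝ = 0 := fun a x =>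
    (Submodule.mem_orthogonal' V u).1 hu _ ((mem_span_insert_range_column A b _).2 ⟨a, x, rfl⟩)
  have hsum : y₁ + e = y - u := by
    rw [eq_sub_iff_add_eq, add_assoc, add_comm e, ← hue, add_sub_cancel]
  have hyb' : ⟪b, y₁ + e⟫_ℝ = ⟪b, y⟫_ℝ := by
    have h1 := hV 1 0
    rw [one_smul, map_zero, add_zero] at h1
    rw [hsum, inner_sub_right, real_inner_comm u b, h1, sub_zero]
  have hyA' : LinearMap.adjoint A (y₁ + e) = c := by
    refine ext_inner_right ℝ fun x => ?_
    have h1 := hV 0 x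
    rw [zero_smul, zero_add] at h1
    rw [LinearMap.adjoint_inner_left, hsum, inner_sub_left, h1, sub_zero, ← hyA,
      LinearMap.adjoint_inner_left]
  have hyK' : y₁ + e ∈ dualCone (pConeProd p k) := by
    intro s hs
    rw [inner_add_left]
    exact add_nonneg (hy₁K s hs) (hEK e he s hs)
  -- The upper bound comes from duality over the face, the lower one from weak duality over K.
  refine ⟨y₁ + e, ⟨hyK', hyA'⟩, le_antisymm (hyb'.trans_le hyb) (hval.2 ?_)⟩
  rintro _ ⟨x, hx, rfl⟩
  have h1 := hyK' _ hx
  rw [inner_sub_right, ← LinearMap.adjoint_inner_left, hyA', real_inner_comm] at h1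
  simpa using h1

end Characterization

end ConicSystem

theorem theorem4p2 {n t : ℕ} (p : Fin t → ℝ) (hp : ∀ i, 1 < p i) (k : Fin t → ℕ)
    (A : EuclideanSpace ℝ (Fin n) →ₗ[ℝ] ConicSystem.BlockSpace k)
    (b z : ConicSystem.BlockSpace k)
    (hz : ConicSystem.IsMaximumSlack A b (ConicSystem.pConeProd p k) z)
    (O R : Set (Fin t))
    (hO : O = {i | z i = 0})
    (hR : R = {i | z i ∈ frontier (ConicSystem.pCone (p i) (k i)) \ {0}}) :
    ConicSystem.BadlyBehaved A b (ConicSystem.pConeProd p k) ↔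
      ∃ v ∈ Submodule.span ℝ (insert b (Set.range (ConicSystem.column A))),
        (∀ i ∈ O, v i ∈ ConicSystem.pCone (p i) (k i)) ∧
        (∀ i ∈ R, 0 ≤ inner ℝ (v i) (ConicSystem.conjugateVector (p i) (z i))) ∧
        (∃ j ∈ R, inner ℝ (v j) (ConicSystem.conjugateVector (p j) (z j)) = 0 ∧
          v j ∉ Submodule.span ℝ {z j}) := by
  subst hO hR
  constructor
  · intro hbad
    by_contra! hno
    exact hbad (ConicSystem.wellBehaved_of_forall_tangent hp hz hno)
  · rintro ⟨v, hv, hvO, hvR, j, hj, -, hvj⟩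
    exact ConicSystem.badlyBehaved_of_tangent hp hz hv hvO hvR hj hvj
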